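/- Let $I=[0,1]$. A bounded degree Borel graph on $I$ is a symmetric Borel set $E\subseteq I^2$ for which there is a positive integer $D$ with $|\{y\in I:(x,y)\in E\}|\le D$ for all $x\in I$. For Borel $A\subseteq I$ put $\deg_A(x)=|\{y\in A:(x,y)\in E\}|$ and $\deg=\deg_I$. A graphing $G=(I,\mu,E)$ consists of such an $E$ and a Borel probability measure $\mu$ on $I$ with $$\int_A\deg_B\,d\mu=\int_B\deg_A\,d\mu\qquad\text{for all Borel }A,B\subseteq I.$$ Its edge measure $\eta$ is the unique Borel measure on $I^2$ with $\eta(A\times B)=\int_A\deg_B\,d\mu$ for all Borel $A,B\subseteq I$. Write $$e_G(A,B)=\eta(A\times B),\qquad \mathrm{vol}(A)=\int_A\deg\,d\mu=e_G(A,I).$$ The graphing $G$ is connected if $e_G(A,A^c)\neq 0$ for every Borel $A\subseteq I$ with $0<\mu(A)<1$. Its Cheeger constant is $$h_G=\inf_{A\subseteq I \text{ Borel},\ 0<\mu(A)<1}\ \frac{e_G(A,A^c)}{\min\{\mathrm{vol}(A),\mathrm{vol}(A^c)\}}.$$ Let $\nu$ be the measure on $I$ with $d\nu=\deg\,d\mu$.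 For $g\in L^2(I,\nu)$ real valued let $\|g\|_v^2=\int_I g^2\,d\nu$, let $(dg)(x,y)=g(y)-g(x)$, let $E^+=\{(x,y)\in E: x<y\}$, and let $\|dg\|_e^2=\int_{E^+}(dg)^2\,d\eta$. The bottom of the spectrum of the Laplacian $\Delta=d^*d$ of $G$ is, by definition, $$\lambda_G=\inf\Big\{\frac{\|dg\|_e^2}{\|g\|_v^2}\ :\ g\in L^2(I,\nu),\ g\neq 0,\ \int_I g\,d\nu=0\Big\}.$$ Both infima are taken in $[0,\infty]$, with $\inf\emptyset=\infty$. **Theorem.** If $G$ is a connected graphing, then $$\lambda_G\ \ge\ \frac{h_G^2}{8}.$$ -/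

import Mathlib

open MeasureTheory ProbabilityTheory Set
open scoped ENNReal unitInterval

noncomputable section

/-- If `T ⊆ I × I` is Borel and all its vertical sections have at most `n` points, then the number
of points of the section over `x` is a Borel function of `x`. -/
theorem measurable_ncard_fiber (n : ℕ) : ∀ T : Set (I × I), MeasurableSet T →
    (∀ x, {y | (x, y) ∈ T}.encard ≤ n) → Measurable fun x => {y | (x, y) ∈ T}.ncard := by
  induction n with
  | zero =>
    intro T _ hn
    have h0 : (fun x : I => {y | (x, y) ∈ T}.ncard) = fun _ => 0 := by
      funext x
      have h1 : {y | (x, y) ∈ T} = ∅ := by simpa using hn x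
      rw [h1, Set.ncard_empty]
    rw [h0]
    exact measurable_const
  | succ n ih =>
    intro T hT hn
    have hfin : ∀ x, {y | (x, y) ∈ T}.Finite := fun x =>
      Set.finite_of_encard_le_coe (hn x)
    have hle : ∀ x, {y | (x, y) ∈ T}.ncard ≤ n + 1 := fun x => by
      have h1 := hn x
      rw [← (hfin x).cast_ncard_eq] at h1
      exact_mod_cast h1
    let V : Set (I × (Fin (n + 1) → I)) :=
      {p | (∀ i j, i < j → p.2 i < p.2 j) ∧ ∀ i, (p.1, p.2 i) ∈ T}
    have hV : MeasurableSet V := by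
      have hVeq : V = (⋂ i, ⋂ j, ⋂ _ : i < j, {p : I × (Fin (n + 1) → I) | p.2 i < p.2 j}) ∩
          ⋂ i, (fun p : I × (Fin (n + 1) → I) => (p.1, p.2 i)) ⁻¹' T := by
        ext p
        simp [V]
      rw [hVeq]
      refine MeasurableSet.inter ?_ ?_
      · refine MeasurableSet.iInter fun i => MeasurableSet.iInter fun j =>
          MeasurableSet.iInter fun _ => measurableSet_lt ?_ ?_ <;> fun_prop
      · refine MeasurableSet.iInter fun i => ?_
        have hm : Measurable fun p : I × (Fin (n + 1) → I) => (p.1, p.2 i) := by fun_prop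
        exact hm hT
    have hrange : ∀ p ∈ V, Set.range p.2 = {y | (p.1, y) ∈ T} := by
      rintro ⟨x, y⟩ ⟨hy, hyT⟩
      have hmono : StrictMono y := fun i j hij => hy i j hij
      refine Set.eq_of_subset_of_ncard_le ?_ ?_ (hfin x)
      · rintro _ ⟨i, rfl⟩
        exact hyT i
      · rw [← Set.image_univ, Set.ncard_image_of_injective _ hmono.injective]
        simpa [Set.ncard_univ] using hle x
    have hinj : Set.InjOn Prod.fst V := by
      rintro ⟨x, y⟩ hp ⟨x', y'⟩ hp' hxx
      have hxx' : x = x' := hxx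
      subst hxx'
      have h1 := (hrange _ hp).trans (hrange _ hp').symm
      have hmono : StrictMono y := fun i j hij => hp.1 i j hij
      have hmono' : StrictMono y' := fun i j hij => hp'.1 i j hij
      have h2 := (StrictMono.range_inj hmono hmono').1 h1
      rw [h2]
    have hU : MeasurableSet (Prod.fst '' V) :=
      hV.image_of_measurable_injOn measurable_fst hinj
    have hmemU : ∀ x, x ∈ Prod.fst '' V ↔ {y | (x, y) ∈ T}.ncard = n + 1 := by
      intro x
      constructor
      · rintro ⟨p, hp, rfl⟩
        have hmono : StrictMono p.2 := fun i j hij => hp.1 i j hij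
        rw [← hrange p hp, ← Set.image_univ, Set.ncard_image_of_injective _ hmono.injective]
        simp [Set.ncard_univ]
      · intro hx
        have hc : (hfin x).toFinset.card = n + 1 := by
          rw [← Set.ncard_eq_toFinset_card _ (hfin x), hx]
        refine ⟨(x, (hfin x).toFinset.orderEmbOfFin hc), ⟨?_, ?_⟩, rfl⟩
        · intro i j hij
          exact ((hfin x).toFinset.orderEmbOfFin hc).strictMono hij
        · intro i
          exact (hfin x).mem_toFinset.1 (Finset.orderEmbOfFin_mem (hfin x).toFinset hc i)
    set U := Prod.fst '' V with hUdef
    have hT' : MeasurableSet (T ∩ Prod.fst ⁻¹' Uᶜ) := hT.inter (measurable_fst hU.compl)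
    have hn' : ∀ x, {y | (x, y) ∈ T ∩ Prod.fst ⁻¹' Uᶜ}.encard ≤ n := by
      intro x
      by_cases hx : x ∈ U
      · have h1 : {y | (x, y) ∈ T ∩ Prod.fst ⁻¹' Uᶜ} = ∅ := by
          ext y; simp [hx]
        rw [h1]; simp
      · have h1 : {y | (x, y) ∈ T ∩ Prod.fst ⁻¹' Uᶜ} = {y | (x, y) ∈ T} := by
          ext y; simp [hx]
        rw [h1, ← (hfin x).cast_ncard_eq]
        have h2 := hle x
        have h3 : {y | (x, y) ∈ T}.ncard ≠ n + 1 := fun h => hx ((hmemU x).2 h)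
        have h4 : {y | (x, y) ∈ T}.ncard ≤ n := by omega
        exact_mod_cast h4
    classical
    have heq : (fun x => {y | (x, y) ∈ T}.ncard) = fun x =>
        if x ∈ U then n + 1 else {y | (x, y) ∈ T ∩ Prod.fst ⁻¹' Uᶜ}.ncard := by
      funext x
      split_ifs with hx
      · exact (hmemU x).1 hx
      · congr 1
        ext y; simp [hx]
    rw [heq]
    exact Measurable.ite hU measurable_const (ih _ hT' hn')

/-- A bounded degree Borel graph on the unit interval `I = [0, 1]`. Loops are allowed. -/
structure BorelGraph where
  /-- the edge set -/
  E : Set (I × I)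
  measurableSet_E : MeasurableSet E
  symm : ∀ x y, (x, y) ∈ E → (y, x) ∈ E
  bounded : ∃ D : ℕ, 0 < D ∧ ∀ x, {y | (x, y) ∈ E}.encard ≤ D

namespace BorelGraph

variable (G : BorelGraph)

/-- `deg_A(x) = |{y ∈ A : (x, y) ∈ E}|`, a natural number because degrees are bounded. -/
def degIn (A : Set I) (x : I) : ℕ := {y | y ∈ A ∧ (x, y) ∈ G.E}.ncard

/-- `deg(x) = |{y ∈ I : (x, y) ∈ E}|`. -/
def deg (x : I) : ℕ := G.degIn univ x

theorem finite_nbhd (x : I) : {y | (x, y) ∈ G.E}.Finite := by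
  obtain ⟨D, -, hD⟩ := G.bounded
  exact Set.finite_of_encard_le_coe (hD x)

theorem measurable_degIn {A : Set I} (hA : MeasurableSet A) : Measurable (G.degIn A) := by
  obtain ⟨D, -, hD⟩ := G.bounded
  have hT : MeasurableSet (Prod.snd ⁻¹' A ∩ G.E) := (measurable_snd hA).inter G.measurableSet_E
  exact measurable_ncard_fiber D _ hT fun x =>
    (Set.encard_le_encard fun y hy => hy.2).trans (hD x)

/-- The counting measure on the set of neighbours of `x`. -/
def nbhdMeasure (x : I) : Measure I := Measure.count.restrict {y | (x, y) ∈ G.E}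

theorem nbhdMeasure_apply (x : I) {A : Set I} (hA : MeasurableSet A) :
    G.nbhdMeasure x A = (G.degIn A x : ℝ≥0∞) := by
  have hf : {y | y ∈ A ∧ (x, y) ∈ G.E}.Finite := (G.finite_nbhd x).subset fun y hy => hy.2
  have h1 : A ∩ {y | (x, y) ∈ G.E} = {y | y ∈ A ∧ (x, y) ∈ G.E} := rfl
  rw [nbhdMeasure, Measure.restrict_apply hA, h1, Measure.count_apply_finite _ hf, degIn,
    Set.ncard_eq_toFinset_card _ hf]

/-- The counting measures on the neighbourhoods as a finite kernel from `I` to `I`. -/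
def nbhdKernel : Kernel I I where
  toFun := G.nbhdMeasure
  measurable' := by
    refine Measure.measurable_of_measurable_coe _ fun A hA => ?_
    simp only [G.nbhdMeasure_apply _ hA]
    exact (measurable_of_countable (fun n : ℕ => (n : ℝ≥0∞))).comp (G.measurable_degIn hA)

theorem nbhdKernel_apply (x : I) {A : Set I} (hA : MeasurableSet A) :
    G.nbhdKernel x A = (G.degIn A x : ℝ≥0∞) := G.nbhdMeasure_apply x hA

instance : IsFiniteKernel G.nbhdKernel := by
  obtain ⟨D, -, hD⟩ := G.bounded
  refine ⟨D, ENNReal.natCast_lt_top D, fun x => ?_⟩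
  rw [G.nbhdKernel_apply x MeasurableSet.univ]
  have hf : {y | y ∈ (univ : Set I) ∧ (x, y) ∈ G.E}.Finite :=
    (G.finite_nbhd x).subset fun y hy => hy.2
  have h1 : ((G.degIn univ x : ℕ) : ℕ∞) ≤ D := by
    rw [degIn, hf.cast_ncard_eq]
    exact (Set.encard_le_encard fun y hy => hy.2).trans (hD x)
  have h2 : G.degIn univ x ≤ D := by exact_mod_cast h1
  exact_mod_cast h2

end BorelGraph

/-- A graphing `(I, μ, E)`: a bounded degree Borel graph on `I` with a Borel probability measure
`μ` such that `∫_A deg_B dμ = ∫_B deg_A dμ` for all measurable `A, B`. -/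
structure Graphing extends BorelGraph where
  /-- the vertex measure -/
  μ : Measure I
  isProbabilityMeasure : IsProbabilityMeasure μ
  fubini : ∀ A B : Set I, MeasurableSet A → MeasurableSet B →
    ∫⁻ x in A, (toBorelGraph.degIn B x : ℝ≥0∞) ∂μ = ∫⁻ x in B, (toBorelGraph.degIn A x : ℝ≥0∞) ∂μ

namespace Graphing

variable (G : Graphing)

instance : IsProbabilityMeasure G.μ := G.isProbabilityMeasure

/-- The edge measure `η` on `I × I`; by `edgeMeasure_prod` below it is the (unique) measure with
`η(A × B) = ∫_A deg_B dμ` on measurable rectangles. -/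
def edgeMeasure : Measure (I × I) := G.μ.compProd G.nbhdKernel

theorem edgeMeasure_prod {A B : Set I} (hA : MeasurableSet A) (hB : MeasurableSet B) :
    G.edgeMeasure (A ×ˢ B) = ∫⁻ x in A, (G.degIn B x : ℝ≥0∞) ∂G.μ := by
  rw [edgeMeasure, Measure.compProd_apply_prod hA hB]
  simp only [G.nbhdKernel_apply _ hB]

/-- `e_G(A, B) = η(A × B) = ∫_A deg_B dμ`. -/
def edgeWeight (A B : Set I) : ℝ≥0∞ := ∫⁻ x in A, (G.degIn B x : ℝ≥0∞) ∂G.μ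

/-- `vol(A) = ∫_A deg dμ`. -/
def vol (A : Set I) : ℝ≥0∞ := ∫⁻ x in A, (G.deg x : ℝ≥0∞) ∂G.μ

/-- `G` is connected if `e_G(A, Aᶜ) ≠ 0` for all measurable `A` with `0 < μ(A) < 1`. -/
def Connected : Prop :=
  ∀ A : Set I, MeasurableSet A → 0 < G.μ A → G.μ A < 1 → G.edgeWeight A Aᶜ ≠ 0

/-- The Cheeger constant `h_G`, as an element of `[0, ∞]`. -/
def cheegerConst : ℝ≥0∞ :=
  ⨅ (A : Set I) (_ : MeasurableSet A) (_ : 0 < G.μ A) (_ : G.μ A < 1),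
    G.edgeWeight A Aᶜ / min (G.vol A) (G.vol Aᶜ)

/-- The vertex measure `ν` with `dν = deg dμ`; the inner product `⟨f, g⟩_v = ∫ f g deg dμ` is that
of `L²(I, ν)`. -/
def vertexMeasure : Measure I := G.μ.withDensity fun x => (G.deg x : ℝ≥0∞)

/-- The edges `(x, y)` with `x < y`: each non-loop edge taken with one orientation. -/
def posEdges : Set (I × I) := {p | p ∈ G.E ∧ p.1 < p.2}

/-- `(dg)(x, y) = g(y) - g(x)`. -/
def grad (g : I → ℝ) (p : I × I) : ℝ := g p.2 - g p.1

/-- `‖g‖_v²`, the squared norm of `L²(I, ν)`. -/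
def vertexNormSq (g : I → ℝ) : ℝ≥0∞ := eLpNorm g 2 G.vertexMeasure ^ 2

/-- `‖φ‖_e²`, the squared norm of `L²(E⁺, η)`. -/
def edgeNormSq (φ : I × I → ℝ) : ℝ≥0∞ := eLpNorm φ 2 (G.edgeMeasure.restrict G.posEdges) ^ 2

/-- `λ_G`, the bottom of the spectrum of the Laplacian, as an element of `[0, ∞]`: the infimum of
the Rayleigh quotients `‖dg‖_e² / ‖g‖_v²` over the nonzero `g ∈ L²(I, ν)` orthogonal to `1`. -/
def bottomSpectrum : ℝ≥0∞ :=
  ⨅ (g : I → ℝ) (_ : MemLp g 2 G.vertexMeasure) (_ : ¬ g =ᵐ[G.vertexMeasure] 0)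
    (_ : ∫ x, g x ∂G.vertexMeasure = 0),
    G.edgeNormSq (grad g) / G.vertexNormSq g

end Graphing

end

/-! Cheeger's argument. Subtract a median `m` from `g` (`exists_median`) and split `g - m = u - w`
into positive and negative parts, each supported on at most half of the volume. As `g` has mean
zero, subtracting `m` can only increase its norm, while the edge energies of `u` and `w` add up to
at most that of `g`. It thus suffices to bound the energy of a function `f ≥ 0` supported on at most
half of the volume.

For such `f`, every superlevel set of `f ^ 2` is the smaller side of a cut. Integrating the
isoperimetric inequality over the levels (`cheegerConst_mul_lintegral_le`) bounds `h ‖f‖²` by the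
integral of `(f(x)² - f(y)²)⁺`, and Cauchy–Schwarz on `|f(x) - f(y)| (f(x) + f(y))` finishes. -/

namespace Graphing

variable (G : Graphing)

/-! ### Symmetry, marginals and support of the edge measure -/

instance : IsFiniteMeasure G.edgeMeasure := by
  unfold edgeMeasure
  infer_instance

theorem map_swap_edgeMeasure : G.edgeMeasure.map Prod.swap = G.edgeMeasure := by
  refine Measure.ext_prod_iff.2 fun {A B} hA hB => ?_
  rw [Measure.map_apply measurable_swap (hA.prod hB), Set.preimage_swap_prod,
    G.edgeMeasure_prod hB hA, G.edgeMeasure_prod hA hB, G.fubini _ _ hB hA]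

theorem vertexMeasure_apply {A : Set I} (hA : MeasurableSet A) :
    G.vertexMeasure A = G.vol A := by
  rw [vertexMeasure, withDensity_apply _ hA, vol]

theorem measurePreserving_swap :
    MeasurePreserving Prod.swap G.edgeMeasure G.edgeMeasure :=
  ⟨measurable_swap, G.map_swap_edgeMeasure⟩

theorem measurePreserving_fst :
    MeasurePreserving Prod.fst G.edgeMeasure G.vertexMeasure := by
  refine ⟨measurable_fst, Measure.ext fun A hA => ?_⟩
  rw [Measure.map_apply measurable_fst hA, G.vertexMeasure_apply hA, ← Set.prod_univ,
    G.edgeMeasure_prod hA .univ]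
  rfl

theorem measurePreserving_snd :
    MeasurePreserving Prod.snd G.edgeMeasure G.vertexMeasure :=
  G.measurePreserving_fst.comp G.measurePreserving_swap

instance : IsFiniteMeasure G.vertexMeasure := by
  rw [← G.measurePreserving_fst.map_eq]
  infer_instance

theorem edgeMeasure_compl_E : G.edgeMeasure G.Eᶜ = 0 := by
  rw [edgeMeasure, Measure.compProd_apply G.measurableSet_E.compl]
  refine (lintegral_congr fun x => ?_).trans lintegral_zero
  change Measure.count.restrict {y | (x, y) ∈ G.E} (Prod.mk x ⁻¹' G.Eᶜ) = 0
  rw [Measure.restrict_apply (measurable_prodMk_left G.measurableSet_E.compl)]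
  convert measure_empty (μ := Measure.count)
  ext y
  simp

/-! ### Isoperimetry and the co-area inequality -/

/-- The infimum only sees `0 < μ A < 1`; in the two excluded cases `ν ≪ μ` and `h` force `ν A = 0`.
-/
theorem cheegerConst_mul_vertexMeasure_le {A : Set I} (hA : MeasurableSet A)
    (h : G.vertexMeasure A ≤ G.vertexMeasure Aᶜ) :
    G.cheegerConst * G.vertexMeasure A ≤ G.edgeMeasure (A ×ˢ Aᶜ) := by
  have hmin : min (G.vol A) (G.vol Aᶜ) = G.vertexMeasure A := by
    rw [← G.vertexMeasure_apply hA, ← G.vertexMeasure_apply hA.compl, min_eq_left h]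
  have hac : G.vertexMeasure ≪ G.μ := withDensity_absolutelyContinuous _ _
  rcases eq_or_ne (G.μ A) 0 with h0 | h0
  · simp [hac h0]
  rcases eq_or_ne (G.μ A) 1 with h1 | h1
  · have h2 : G.μ Aᶜ = 0 := (prob_compl_eq_zero_iff hA).2 h1
    have h3 : G.vertexMeasure A = 0 := le_antisymm (h.trans (hac h2).le) zero_le
    simp [h3]
  rw [G.edgeMeasure_prod hA hA.compl]
  refine ENNReal.mul_le_of_le_div ?_
  rw [← hmin]
  exact iInf_le_of_le A <| iInf_le_of_le hA <| iInf_le_of_le (pos_iff_ne_zero.2 h0) <|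
    iInf_le _ (lt_of_le_of_ne prob_le_one h1)

/-- The co-area inequality: for `F ≥ 0` supported on at most half of the volume. -/
theorem cheegerConst_mul_lintegral_le {F : I → ℝ} (hF : Measurable F) (hF0 : ∀ x, 0 ≤ F x)
    (hfin : ∫⁻ x, ENNReal.ofReal (F x) ∂G.vertexMeasure ≠ ∞)
    (hsupp : G.vertexMeasure {x | 0 < F x} ≤ G.vertexMeasure univ / 2) :
    G.cheegerConst * ∫⁻ x, ENNReal.ofReal (F x) ∂G.vertexMeasure ≤
      ∫⁻ p, ENNReal.ofReal (F p.1 - F p.2) ∂G.edgeMeasure := by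
  have hF1 : Measurable fun p : I × I => F p.1 := hF.comp measurable_fst
  have hF2 : Measurable fun p : I × I => F p.2 := hF.comp measurable_snd
  -- For `S = {t < F}`, the sets `S × Sᶜ` and `I × S` are disjoint with union `{t < max (F x) (F
  -- y)}`. Adding `ν S` to both sides thus lets the layer-cake formula be applied to a maximum; the
  -- added integral is cancelled at the end, by `hfin`.
  have hlevel : ∀ t : ℝ, 0 < t →
      G.cheegerConst * G.vertexMeasure {x | t < F x} + G.vertexMeasure {x | t < F x} ≤
        G.edgeMeasure {p | t < max (F p.1) (F p.2)} := by
    intro t ht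
    have hS : MeasurableSet {x | t < F x} := measurableSet_lt measurable_const hF
    have h1 : G.vertexMeasure {x | t < F x} ≤ G.vertexMeasure univ / 2 :=
      (measure_mono fun x hx => ht.trans hx).trans hsupp
    have h2 : G.vertexMeasure {x | t < F x} ≤ G.vertexMeasure {x | t < F x}ᶜ := by
      rw [measure_compl hS (measure_ne_top _ _)]
      refine ENNReal.le_sub_of_add_le_left (measure_ne_top _ _) ?_
      calc _ ≤ G.vertexMeasure univ / 2 + G.vertexMeasure univ / 2 := add_le_add h1 h1
        _ = _ := ENNReal.add_halves _
    refine (add_le_add_left (G.cheegerConst_mul_vertexMeasure_le hS h2) _).trans ?_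
    rw [← G.measurePreserving_snd.measure_preimage hS.nullMeasurableSet,
      ← measure_union _ (measurable_snd hS)]
    · refine measure_mono ?_
      rintro p (⟨hp, -⟩ | hp)
      · exact lt_max_iff.2 (.inl (show t < F p.1 from hp))
      · exact lt_max_iff.2 (.inr (show t < F p.2 from hp))
    · exact Set.disjoint_left.2 fun p hp hp' => hp.2 hp'
  have hmax : ∫⁻ p, ENNReal.ofReal (max (F p.1) (F p.2)) ∂G.edgeMeasure =
      ∫⁻ p, ENNReal.ofReal (F p.1 - F p.2) ∂G.edgeMeasure +
        ∫⁻ x, ENNReal.ofReal (F x) ∂G.vertexMeasure := by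
    rw [← G.measurePreserving_snd.lintegral_comp hF.ennreal_ofReal,
      ← lintegral_add_right _ hF2.ennreal_ofReal]
    refine lintegral_congr fun p => ?_
    rcases le_total (F p.1) (F p.2) with h | h
    · rw [max_eq_right h, ENNReal.ofReal_of_nonpos (sub_nonpos.2 h), zero_add]
    · rw [max_eq_left h, ← ENNReal.ofReal_add (sub_nonneg.2 h) (hF0 _), sub_add_cancel]
  have hle : G.cheegerConst * ∫⁻ x, ENNReal.ofReal (F x) ∂G.vertexMeasure +
      ∫⁻ x, ENNReal.ofReal (F x) ∂G.vertexMeasure ≤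
        ∫⁻ p, ENNReal.ofReal (max (F p.1) (F p.2)) ∂G.edgeMeasure := by
    rw [lintegral_eq_lintegral_meas_lt _ (.of_forall hF0) hF.aemeasurable,
      lintegral_eq_lintegral_meas_lt _ (f := fun p : I × I => max (F p.1) (F p.2))
        (.of_forall fun p => le_max_of_le_left (hF0 p.1)) (hF1.max hF2).aemeasurable]
    have hanti : Measurable fun t : ℝ => G.vertexMeasure {x | t < F x} :=
      Antitone.measurable fun s t hst => measure_mono fun x hx => lt_of_le_of_lt hst hx
    rw [← lintegral_const_mul _ hanti, ← lintegral_add_right _ hanti]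
    exact setLIntegral_mono' measurableSet_Ioi fun t ht => hlevel t ht
  rw [hmax] at hle
  exact (ENNReal.add_le_add_iff_right hfin).1 hle

/-! ### Norms as integrals and the inequality on half of the volume -/

theorem vertexNormSq_eq_lintegral (g : I → ℝ) :
    G.vertexNormSq g = ∫⁻ x, ENNReal.ofReal (g x ^ 2) ∂G.vertexMeasure := by
  rw [vertexNormSq, ← ENNReal.rpow_natCast]
  have h := eLpNorm_nnreal_pow_eq_lintegral (f := g) (μ := G.vertexMeasure) (p := 2) two_ne_zero
  simp only [NNReal.coe_ofNat, ENNReal.coe_ofNat] at h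
  simp only [Nat.cast_ofNat, h]
  refine lintegral_congr fun x => ?_
  rw [← ofReal_norm, ENNReal.ofReal_rpow_of_nonneg (norm_nonneg _) zero_le_two]
  simp

theorem edgeNormSq_eq_lintegral (φ : I × I → ℝ) :
    G.edgeNormSq φ = ∫⁻ p in G.posEdges, ENNReal.ofReal (φ p ^ 2) ∂G.edgeMeasure := by
  rw [edgeNormSq, ← ENNReal.rpow_natCast]
  have h := eLpNorm_nnreal_pow_eq_lintegral (f := φ) (μ := G.edgeMeasure.restrict G.posEdges)
    (p := 2) two_ne_zero
  simp only [NNReal.coe_ofNat, ENNReal.coe_ofNat] at h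
  simp only [Nat.cast_ofNat, h]
  refine lintegral_congr fun x => ?_
  rw [← ofReal_norm, ENNReal.ofReal_rpow_of_nonneg (norm_nonneg _) zero_le_two]
  simp

/-- The swap exchanges the two orientations and preserves `η`, and the gradient vanishes on loops.
-/
theorem lintegral_sq_grad_le {f : I → ℝ} (hf : Measurable f) :
    ∫⁻ p, ENNReal.ofReal (grad f p ^ 2) ∂G.edgeMeasure ≤ 2 * G.edgeNormSq (grad f) := by
  have hm : Measurable fun p : I × I => ENNReal.ofReal (grad f p ^ 2) :=
    (((hf.comp measurable_snd).sub (hf.comp measurable_fst)).pow_const 2).ennreal_ofReal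
  have hlt : MeasurableSet {p : I × I | p.1 < p.2} := measurableSet_lt measurable_fst measurable_snd
  have hpos : G.edgeNormSq (grad f) =
      ∫⁻ p in {p : I × I | p.1 < p.2}, ENNReal.ofReal (grad f p ^ 2) ∂G.edgeMeasure := by
    rw [edgeNormSq_eq_lintegral]
    refine setLIntegral_congr ?_
    have hE : ∀ᵐ p ∂G.edgeMeasure, p ∈ G.E := G.edgeMeasure_compl_E
    filter_upwards [hE] with p hp
    exact propext ⟨fun h => h.2, fun h => ⟨hp, h⟩⟩
  have hswap : G.edgeNormSq (grad f) =
      ∫⁻ p in {p : I × I | p.2 < p.1}, ENNReal.ofReal (grad f p ^ 2) ∂G.edgeMeasure := by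
    rw [hpos, ← G.measurePreserving_swap.setLIntegral_comp_preimage hlt hm]
    refine lintegral_congr fun p => ?_
    simp only [grad, Prod.fst_swap, Prod.snd_swap]
    rw [← neg_sub, neg_sq]
  have hgt : MeasurableSet {p : I × I | p.2 < p.1} := measurableSet_lt measurable_snd measurable_fst
  rw [two_mul]
  nth_rewrite 1 [hpos]
  rw [hswap, ← lintegral_indicator hlt, ← lintegral_indicator hgt,
    ← lintegral_add_left (hm.indicator hlt)]
  refine lintegral_mono fun p => ?_
  rcases lt_trichotomy p.1 p.2 with h | h | h
  · simp [Set.indicator, h]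
  · simp [grad, h]
  · simp [Set.indicator, h]

theorem lintegral_mul_sq_le {α : Type*} [MeasurableSpace α] (μ : Measure α) {a b : α → ℝ≥0∞}
    (ha : AEMeasurable a μ) (hb : AEMeasurable b μ) :
    (∫⁻ x, a x * b x ∂μ) ^ 2 ≤ (∫⁻ x, a x ^ 2 ∂μ) * ∫⁻ x, b x ^ 2 ∂μ := by
  have h := ENNReal.lintegral_mul_le_Lp_mul_Lq μ Real.HolderConjugate.two_two ha hb
  have h2 : ∀ c : ℝ≥0∞, (c ^ (1 / 2 : ℝ)) ^ 2 = c := fun c => by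
    rw [← ENNReal.rpow_natCast, ← ENNReal.rpow_mul]; norm_num
  calc _ ≤ _ := pow_le_pow_left' h 2
    _ = _ := by rw [mul_pow, h2, h2]; simp only [ENNReal.rpow_two]

/-- Cheeger's inequality for nonnegative functions supported on at most half of the volume. -/
theorem cheegerConst_sq_mul_vertexNormSq_le {f : I → ℝ} (hf : Measurable f) (hf0 : ∀ x, 0 ≤ f x)
    (hfin : G.vertexNormSq f ≠ ∞)
    (hsupp : G.vertexMeasure {x | 0 < f x} ≤ G.vertexMeasure univ / 2) :
    G.cheegerConst ^ 2 / 8 * G.vertexNormSq f ≤ G.edgeNormSq (grad f) := by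
  have hf1 : Measurable fun p : I × I => f p.1 := hf.comp measurable_fst
  have hf2 : Measurable fun p : I × I => f p.2 := hf.comp measurable_snd
  have hV := G.vertexNormSq_eq_lintegral f
  have hcoarea : G.cheegerConst * G.vertexNormSq f ≤
      ∫⁻ p, ENNReal.ofReal (f p.1 ^ 2 - f p.2 ^ 2) ∂G.edgeMeasure := by
    rw [hV] at hfin ⊢
    refine G.cheegerConst_mul_lintegral_le (hf.pow_const 2) (fun x => sq_nonneg _) hfin ?_
    refine (measure_mono fun x hx => ?_).trans hsupp
    exact (hf0 x).lt_of_ne fun h => by simp [← h] at hx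
  -- Replacing a positive part by an absolute value loses a factor 2 here, by symmetry of `η`; this
  -- is affordable for the constant 8.
  have hprod : ∫⁻ p, ENNReal.ofReal (f p.1 ^ 2 - f p.2 ^ 2) ∂G.edgeMeasure ≤
      ∫⁻ p, ENNReal.ofReal |grad f p| * ENNReal.ofReal (f p.1 + f p.2) ∂G.edgeMeasure := by
    refine lintegral_mono fun p => ?_
    rw [← ENNReal.ofReal_mul (abs_nonneg _)]
    refine ENNReal.ofReal_le_ofReal ?_
    have h1 : f p.1 ^ 2 - f p.2 ^ 2 = -(grad f p) * (f p.1 + f p.2) := by simp only [grad]; ring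
    rw [h1]
    exact mul_le_mul_of_nonneg_right (neg_le_abs _) (add_nonneg (hf0 _) (hf0 _))
  have hsum : ∫⁻ p, ENNReal.ofReal (f p.1 + f p.2) ^ 2 ∂G.edgeMeasure ≤ 4 * G.vertexNormSq f := by
    have h1 := G.measurePreserving_fst.lintegral_comp (hf.pow_const 2).ennreal_ofReal
    have h2 := G.measurePreserving_snd.lintegral_comp (hf.pow_const 2).ennreal_ofReal
    calc _ ≤ ∫⁻ p, (2 * ENNReal.ofReal (f p.1 ^ 2) + 2 * ENNReal.ofReal (f p.2 ^ 2))
          ∂G.edgeMeasure := by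
          refine lintegral_mono fun p => ?_
          rw [← ENNReal.ofReal_pow (add_nonneg (hf0 _) (hf0 _)), ← mul_add,
            ← ENNReal.ofReal_add (sq_nonneg _) (sq_nonneg _), ← ENNReal.ofReal_ofNat,
            ← ENNReal.ofReal_mul zero_le_two]
          exact ENNReal.ofReal_le_ofReal add_sq_le
      _ = 4 * G.vertexNormSq f := by
          rw [lintegral_add_left ((hf1.pow_const 2).ennreal_ofReal.const_mul 2),
            lintegral_const_mul _ (hf1.pow_const 2).ennreal_ofReal,
            lintegral_const_mul _ (hf2.pow_const 2).ennreal_ofReal, h1, h2, hV]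
          ring
  have hgrad : ∫⁻ p, ENNReal.ofReal |grad f p| ^ 2 ∂G.edgeMeasure ≤
      2 * G.edgeNormSq (grad f) := by
    refine le_trans (le_of_eq (lintegral_congr fun p => ?_)) (G.lintegral_sq_grad_le hf)
    rw [← ENNReal.ofReal_pow (abs_nonneg _), sq_abs]
  have hCS := lintegral_mul_sq_le G.edgeMeasure
    (a := fun p => ENNReal.ofReal |grad f p|) (b := fun p => ENNReal.ofReal (f p.1 + f p.2))
    (hf2.sub hf1).abs.ennreal_ofReal.aemeasurable (hf1.add hf2).ennreal_ofReal.aemeasurable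
  -- The constant is `8 = 2 * 4`: two orientations of each edge, and `(a + b)² ≤ 2a² + 2b²` with
  -- both marginals of `η` equal to `ν`.
  have hmain : (G.cheegerConst * G.vertexNormSq f) ^ 2 ≤
      2 * G.edgeNormSq (grad f) * (4 * G.vertexNormSq f) :=
    (pow_le_pow_left' (hcoarea.trans hprod) 2).trans (hCS.trans (mul_le_mul' hgrad hsum))
  rcases eq_or_ne (G.vertexNormSq f) 0 with h0 | h0
  · simp [h0]
  have h8 : G.cheegerConst ^ 2 * G.vertexNormSq f ≤ 8 * G.edgeNormSq (grad f) := by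
    refine (ENNReal.mul_le_mul_iff_left h0 hfin).1 ?_
    calc _ = (G.cheegerConst * G.vertexNormSq f) ^ 2 := by ring
      _ ≤ _ := hmain
      _ = _ := by ring
  rw [← ENNReal.mul_div_right_comm]
  exact ENNReal.div_le_of_le_mul' h8

end Graphing

/-! ### Medians and shifts of mean-zero functions -/

/-- Take the infimum of the levels `t` with `ν {t < g} ≤ ν univ / 2`. Both strict sets at the
infimum are increasing unions of sets at nearby levels, so the bounds pass to the limit. For `ν = 0`
the levels are unbounded below, hence the separate case. -/
theorem exists_median {α : Type*} [MeasurableSpace α] (ν : Measure α) [IsFiniteMeasure ν]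
    {g : α → ℝ} (hg : Measurable g) :
    ∃ m : ℝ, ν {x | m < g x} ≤ ν univ / 2 ∧ ν {x | g x < m} ≤ ν univ / 2 := by
  rcases eq_or_ne (ν univ) 0 with h0 | h0
  · have h1 : ν = 0 := Measure.measure_univ_eq_zero.1 h0
    exact ⟨0, by simp [h1], by simp [h1]⟩
  have hhalf : ν univ / 2 < ν univ := ENNReal.half_lt_self h0 (measure_ne_top _ _)
  have hpos : 0 < ν univ / 2 := ENNReal.half_pos h0
  let T : Set ℝ := {t | ν {x | t < g x} ≤ ν univ / 2}
  have hanti : Antitone fun n : ℕ => {x | (n : ℝ) < g x} := fun m n hmn x hx =>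
    lt_of_le_of_lt (Nat.cast_le.2 hmn : (m : ℝ) ≤ n) hx
  have hne : T.Nonempty := by
    have h1 := tendsto_measure_iInter_atTop (μ := ν)
      (fun n : ℕ => (measurableSet_lt measurable_const hg : MeasurableSet
        {x | (n : ℝ) < g x}).nullMeasurableSet) hanti ⟨0, measure_ne_top _ _⟩
    have h2 : ⋂ n : ℕ, {x | (n : ℝ) < g x} = ∅ := by
      ext x
      obtain ⟨n, hn⟩ := exists_nat_ge (g x)
      simp only [mem_iInter, mem_ofPred_eq, mem_empty_iff_false, iff_false, not_forall, not_lt]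
      exact ⟨n, hn⟩
    rw [h2, measure_empty] at h1
    obtain ⟨n, hn⟩ := (h1.eventually_lt_const hpos).exists
    exact ⟨n, hn.le⟩
  have hmono : Monotone fun n : ℕ => {x | -(n : ℝ) < g x} := fun m n hmn x hx =>
    lt_of_le_of_lt (neg_le_neg (Nat.cast_le.2 hmn) : -(n : ℝ) ≤ -m) hx
  have hbdd : BddBelow T := by
    have h1 := tendsto_measure_iUnion_atTop (μ := ν) hmono
    have h2 : ⋃ n : ℕ, {x | -(n : ℝ) < g x} = univ := by
      ext x
      obtain ⟨n, hn⟩ := exists_nat_gt (-g x)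
      simp only [mem_iUnion, mem_ofPred_eq, mem_univ, iff_true]
      exact ⟨n, neg_lt.1 hn⟩
    rw [h2] at h1
    obtain ⟨n, hn⟩ := (h1.eventually_const_lt hhalf).exists
    refine ⟨-n, fun t ht => le_of_not_gt fun htn => ?_⟩
    exact absurd ((measure_mono fun x hx => htn.trans hx).trans ht) (not_le.2 hn)
  have hup : ∀ t, sInf T < t → ν {x | t < g x} ≤ ν univ / 2 := by
    intro t ht
    obtain ⟨s, hs, hst⟩ := (csInf_lt_iff hbdd hne).1 ht
    exact (measure_mono fun x hx => hst.trans hx).trans hs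
  have hlow : ∀ t, t < sInf T → ν {x | g x ≤ t} ≤ ν univ / 2 := by
    intro t ht
    have h1 : ν univ / 2 < ν {x | t < g x} := not_le.1 fun h => absurd (csInf_le hbdd h) (not_le.2 ht)
    have h2 : {x | g x ≤ t} = {x | t < g x}ᶜ := by ext x; simp
    rw [h2, measure_compl (measurableSet_lt measurable_const hg) (measure_ne_top _ _)]
    refine tsub_le_iff_right.2 ?_
    calc ν univ = ν univ / 2 + ν univ / 2 := (ENNReal.add_halves _).symm
      _ ≤ _ := add_le_add_right h1.le _
  refine ⟨sInf T, ?_, ?_⟩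
  · obtain ⟨u, hu, hu1, hu2⟩ := exists_seq_strictAnti_tendsto (sInf T)
    have h1 : {x | sInf T < g x} = ⋃ n, {x | u n < g x} := by
      ext x
      simp only [mem_iUnion, mem_ofPred_eq]
      exact ⟨fun h => (hu2.eventually_lt_const h).exists, fun ⟨n, hn⟩ => (hu1 n).trans hn⟩
    have hm : Monotone fun n => {x | u n < g x} := fun m n hmn x hx =>
      lt_of_le_of_lt (hu.antitone hmn) hx
    rw [h1, hm.measure_iUnion]
    exact iSup_le fun n => hup _ (hu1 n)
  · obtain ⟨u, hu, hu1, hu2⟩ := exists_seq_strictMono_tendsto (sInf T)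
    have h1 : {x | g x < sInf T} = ⋃ n, {x | g x ≤ u n} := by
      ext x
      simp only [mem_iUnion, mem_ofPred_eq]
      exact ⟨fun h => (hu2.eventually_const_lt h).exists.imp fun _ h => h.le,
        fun ⟨n, hn⟩ => lt_of_le_of_lt hn (hu1 n)⟩
    have hm : Monotone fun n => {x | g x ≤ u n} := fun m n hmn x hx =>
      le_trans hx (hu.monotone hmn)
    rw [h1, hm.measure_iUnion]
    exact iSup_le fun n => hlow _ (hu1 n)

theorem lintegral_sq_le_lintegral_sub_const_sq {α : Type*} [MeasurableSpace α] (ν : Measure α)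
    [IsFiniteMeasure ν] {g : α → ℝ} (hg : MemLp g 2 ν) (h0 : ∫ x, g x ∂ν = 0) (m : ℝ) :
    ∫⁻ x, ENNReal.ofReal (g x ^ 2) ∂ν ≤ ∫⁻ x, ENNReal.ofReal ((g x - m) ^ 2) ∂ν := by
  have hi : Integrable g ν := hg.integrable one_le_two
  have hi2 : Integrable (fun x => g x ^ 2) ν := hg.integrable_sq
  have hi3 : Integrable (fun x => (g x - m) ^ 2) ν := (hg.sub (memLp_const m)).integrable_sq
  rw [← ofReal_integral_eq_lintegral_ofReal hi2 (.of_forall fun x => sq_nonneg _),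
    ← ofReal_integral_eq_lintegral_ofReal hi3 (.of_forall fun x => sq_nonneg _)]
  refine ENNReal.ofReal_le_ofReal ?_
  have h1 : ∫ x, (g x - m) ^ 2 ∂ν = ∫ x, g x ^ 2 ∂ν - 2 * m * ∫ x, g x ∂ν + ∫ _, m ^ 2 ∂ν := by
    have hi4 : Integrable (fun x => 2 * m * g x) ν := hi.const_mul _
    have hi5 : Integrable (fun x => g x ^ 2 - 2 * m * g x) ν := hi2.sub hi4
    rw [← integral_const_mul, ← integral_sub hi2 hi4, ← integral_add hi5 (integrable_const _)]
    refine integral_congr_ae (.of_forall fun x => ?_)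
    simp only
    ring
  rw [h1, h0, mul_zero, sub_zero]
  exact le_add_of_nonneg_right (integral_nonneg fun _ => sq_nonneg m)

/-! ### Splitting at the median and the conclusion -/

namespace Graphing

variable (G : Graphing)

theorem vertexNormSq_congr {f g : I → ℝ} (h : f =ᵐ[G.vertexMeasure] g) :
    G.vertexNormSq f = G.vertexNormSq g := by
  rw [vertexNormSq, vertexNormSq, eLpNorm_congr_ae h]

theorem edgeNormSq_grad_congr {f g : I → ℝ} (h : f =ᵐ[G.vertexMeasure] g) :
    G.edgeNormSq (grad f) = G.edgeNormSq (grad g) := by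
  have h1 : grad f =ᵐ[G.edgeMeasure] grad g := by
    filter_upwards [G.measurePreserving_fst.quasiMeasurePreserving.ae_eq_comp h,
      G.measurePreserving_snd.quasiMeasurePreserving.ae_eq_comp h] with p h1 h2
    simp only [Function.comp_apply] at h1 h2
    rw [grad, grad, h1, h2]
  rw [edgeNormSq, edgeNormSq, eLpNorm_congr_ae (ae_restrict_of_ae h1)]

/-- Cheeger's inequality for a measurable function of mean zero. -/
theorem cheegerConst_sq_mul_vertexNormSq_le_of_integral_eq_zero {g : I → ℝ} (hg : Measurable g)
    (hL : MemLp g 2 G.vertexMeasure) (h0 : ∫ x, g x ∂G.vertexMeasure = 0) :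
    G.cheegerConst ^ 2 / 8 * G.vertexNormSq g ≤ G.edgeNormSq (grad g) := by
  obtain ⟨m, hm1, hm2⟩ := exists_median G.vertexMeasure hg
  let u : I → ℝ := fun x => max (g x - m) 0
  let w : I → ℝ := fun x => max (m - g x) 0
  have hu : Measurable u := (hg.sub_const m).max measurable_const
  have hw : Measurable w := (hg.const_sub m).max measurable_const
  have huw : ∀ x, u x ^ 2 + w x ^ 2 = (g x - m) ^ 2 := by
    intro x
    rcases le_total (g x) m with h | h
    · simp only [u, w, max_eq_right (sub_nonpos.2 h), max_eq_left (sub_nonneg.2 h)]; ring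
    · simp only [u, w, max_eq_left (sub_nonneg.2 h), max_eq_right (sub_nonpos.2 h)]; ring
  have hsum : G.vertexNormSq u + G.vertexNormSq w =
      ∫⁻ x, ENNReal.ofReal ((g x - m) ^ 2) ∂G.vertexMeasure := by
    rw [vertexNormSq_eq_lintegral, vertexNormSq_eq_lintegral,
      ← lintegral_add_left (hu.pow_const 2).ennreal_ofReal]
    refine lintegral_congr fun x => ?_
    rw [← ENNReal.ofReal_add (sq_nonneg _) (sq_nonneg _), huw]
  have hfin : G.vertexNormSq u + G.vertexNormSq w ≠ ∞ := by
    rw [hsum]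
    exact (hL.sub (memLp_const m)).integrable_sq.lintegral_lt_top.ne
  have hgrad : G.edgeNormSq (grad u) + G.edgeNormSq (grad w) ≤ G.edgeNormSq (grad g) := by
    have hm : Measurable fun p => ENNReal.ofReal (grad u p ^ 2) :=
      (((hu.comp measurable_snd).sub (hu.comp measurable_fst)).pow_const 2).ennreal_ofReal
    rw [edgeNormSq_eq_lintegral, edgeNormSq_eq_lintegral, edgeNormSq_eq_lintegral,
      ← lintegral_add_left hm]
    refine lintegral_mono fun p => ?_
    rw [← ENNReal.ofReal_add (sq_nonneg _) (sq_nonneg _)]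
    refine ENNReal.ofReal_le_ofReal ?_
    have key : ∀ x, g x - m = u x - w x ∧ 0 ≤ u x ∧ 0 ≤ w x ∧ u x * w x = 0 := by
      intro x
      rcases le_total (g x) m with h | h
      · simp [u, w, h]
      · simp [u, w, h]
    obtain ⟨a1, a2, a3, a4⟩ := key p.1
    obtain ⟨b1, b2, b3, b4⟩ := key p.2
    have h1 : grad g p = grad u p - grad w p := by
      simp only [grad]
      linarith
    -- As `u w = 0` at both endpoints, the product equals `-(u(x) w(y) + u(y) w(x))`.
    have h2 : grad u p * grad w p ≤ 0 := by
      simp only [grad]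
      nlinarith [mul_nonneg b2 a3, mul_nonneg a2 b3]
    rw [h1]
    linarith [sub_sq (grad u p) (grad w p)]
  calc G.cheegerConst ^ 2 / 8 * G.vertexNormSq g
      ≤ G.cheegerConst ^ 2 / 8 * (G.vertexNormSq u + G.vertexNormSq w) := by
        rw [hsum, vertexNormSq_eq_lintegral]
        exact mul_le_mul' le_rfl (lintegral_sq_le_lintegral_sub_const_sq _ hL h0 m)
    _ = G.cheegerConst ^ 2 / 8 * G.vertexNormSq u + G.cheegerConst ^ 2 / 8 * G.vertexNormSq w :=
        mul_add _ _ _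
    _ ≤ G.edgeNormSq (grad u) + G.edgeNormSq (grad w) := by
        refine add_le_add
          (G.cheegerConst_sq_mul_vertexNormSq_le hu (fun x => le_max_right _ _)
            (ne_top_of_le_ne_top hfin le_self_add) ?_)
          (G.cheegerConst_sq_mul_vertexNormSq_le hw (fun x => le_max_right _ _)
            (ne_top_of_le_ne_top hfin le_add_self) ?_)
        · simpa [u] using hm1
        · simpa [w] using hm2
    _ ≤ _ := hgrad

end Graphing

theorem mainTheorem2 (G : Graphing) (hG : G.Connected) :
    G.bottomSpectrum ≥ G.cheegerConst ^ 2 / 8 := by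
  refine le_iInf fun g => le_iInf fun hL => le_iInf fun hne => le_iInf fun h0 => ?_
  -- Level sets must be Borel, so `g` is replaced by a measurable version; the energy is unchanged
  -- because `ν`-null sets pull back to `η`-null sets under both projections.
  have hae := hL.1.aemeasurable.ae_eq_mk
  set g' := hL.1.aemeasurable.mk g with hg'
  have hV0 : G.vertexNormSq g ≠ 0 := by
    intro h
    exact hne ((eLpNorm_eq_zero_iff hL.1 two_ne_zero).1 (pow_eq_zero_iff two_ne_zero |>.1 h))
  have hVtop : G.vertexNormSq g ≠ ∞ := ENNReal.pow_ne_top hL.2.ne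
  rw [ENNReal.le_div_iff_mul_le (.inl hV0) (.inl hVtop), G.vertexNormSq_congr hae,
    G.edgeNormSq_grad_congr hae]
  exact G.cheegerConst_sq_mul_vertexNormSq_le_of_integral_eq_zero
    hL.1.aemeasurable.measurable_mk (hL.ae_eq hae) ((integral_congr_ae hae).symm.trans h0)
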